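/- Let $r,s\ge 3$ and $\ell\ge 1$ be integers with $r$ even and $s$ odd, and let $D_{r,s,\ell}$ be the dumbbell graph obtained from two vertex-disjoint cycles $C_r$ and $C_s$ by choosing one vertex on each and joining these two vertices by a path of length $\ell$ (so $D_{r,s,\ell}$ has $r+s+\ell-1$ vertices). A complex unit gain graph $\Phi=(D_{r,s,\ell},\varphi)$ is given by a function $\varphi$ that assigns to every oriented edge a complex number of modulus $1$ with $\varphi(u,v)=\varphi(v,u)^{-1}$. Its Hermitian adjacency matrix $A(\Phi)$ has entries $\varphi(u,v)$ for adjacent $u,v$ and $0$ otherwise, and its energy $E(\Phi)$ is the sum of the absolute values of the eigenvalues of $A(\Phi)$, counted with multiplicity. Let $\gamma_r$ and $\gamma_s$ be the gains of the cycles $C_r$ and $C_s$, that is, the products of the gains of their consecutive oriented edges (the real parts do not depend on the starting vertex or the orientation), and put $$\alpha=(-1)^{r/2}\operatorname{Re}\gamma_r,\qquad \beta=(-1)^{(s+1)/2}\operatorname{Re}\gamma_s .$$ Then, among all complex unit gain graphs $\Phi$ on $D_{r,s,\ell}$, the maximum of the energy $E(\Phi)$ is attained exactly when $\alpha=-1$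 and $\beta=\pm1$. That is, $\Phi$ has maximum energy if and only if $\alpha=-1$ and $\beta\in\{1,-1\}$, and both pairs $(\alpha,\beta)=(-1,1)$ and $(\alpha,\beta)=(-1,-1)$ occur. -/

import Mathlib

/-- A complex unit gain function on a simple graph `G`: each oriented edge gets a complex number
of modulus one, and reversing the edge inverts it. -/
structure UnitGain {V : Type*} (G : SimpleGraph V) where
  /-- the gain of an oriented edge -/
  gain : G.Dart → Circle
  gain_symm : ∀ d : G.Dart, gain d.symm = (gain d)⁻¹

namespace UnitGain

variable {V : Type*} {G : SimpleGraph V}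

open Classical in
/-- The Hermitian adjacency matrix of a gain graph. -/
noncomputable def adjMatrix (Φ : UnitGain G) : Matrix V V ℂ :=
  Matrix.of fun u v => if h : G.Adj u v then (Φ.gain ⟨(u, v), h⟩ : ℂ) else 0

theorem adjMatrix_isHermitian (Φ : UnitGain G) : Φ.adjMatrix.IsHermitian := by
  ext u v
  by_cases h : G.Adj u v
  · have h2 : G.Adj v u := h.symm
    have key := Φ.gain_symm ⟨(u, v), h⟩
    have e : (SimpleGraph.Dart.symm ⟨(u, v), h⟩ : G.Dart) = ⟨(v, u), h2⟩ := rfl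
    rw [e] at key
    simp [adjMatrix, Matrix.conjTranspose_apply, h, h2, key, ← Circle.coe_inv_eq_conj]
  · have h2 : ¬ G.Adj v u := fun h' => h h'.symm
    simp [adjMatrix, h, h2]

open Classical in
/-- The energy of a gain graph: the sum of the absolute values of the eigenvalues (with
multiplicity) of its Hermitian adjacency matrix. -/
noncomputable def energy [Fintype V] (Φ : UnitGain G) : ℝ :=
  ∑ j, |Φ.adjMatrix_isHermitian.eigenvalues j|

/-- The gain of the cycle `c 0, c 1, …, c (k - 1), c 0` of `G`: the product of the gains of its
consecutive oriented edges. Here `finRotate k i` is `i + 1` modulo `k`. -/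
noncomputable def cycleGain (Φ : UnitGain G) {k : ℕ} (c : Fin k → V)
    (hc : ∀ i, G.Adj (c i) (c (finRotate k i))) : Circle :=
  ∏ i, Φ.gain ⟨(c i, c (finRotate k i)), hc i⟩

end UnitGain

/-- The dumbbell graph `D_{r,s,ℓ}` (for `3 ≤ r`, `3 ≤ s`, `1 ≤ ℓ`) on the `r + s + ℓ - 1` vertices
`0, 1, …, r + s + ℓ - 2`. The vertices `0, …, r - 1` form the cycle `C_r`, the vertices
`r + ℓ - 1, …, r + s + ℓ - 2` form the cycle `C_s`, and `r - 1, r, …, r + ℓ - 1` is the path of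
length `ℓ` that joins them. So the edges are all pairs of consecutive numbers together with the
closing edges `{0, r - 1}` and `{r + ℓ - 1, r + s + ℓ - 2}` of the two cycles. -/
def dumbbell (r s ℓ : ℕ) : SimpleGraph (Fin (r + s + ℓ - 1)) :=
  SimpleGraph.fromRel fun i j =>
    i.val + 1 = j.val ∨
    (i.val = 0 ∧ j.val + 1 = r) ∨
    (i.val + 1 = r + ℓ ∧ j.val + 2 = r + s + ℓ)

namespace dumbbell

variable {r s ℓ : ℕ}

/-- The vertices of the cycle `C_r`, in cyclic order. -/
def leftCycle (hs : 3 ≤ s) (i : Fin r) : Fin (r + s + ℓ - 1) :=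
  ⟨i.val, by omega⟩

/-- The vertices of the cycle `C_s`, in cyclic order. -/
def rightCycle (hr : 3 ≤ r) (i : Fin s) : Fin (r + s + ℓ - 1) :=
  ⟨r + ℓ - 1 + i.val, by omega⟩

theorem finRotate_val {k : ℕ} (i : Fin k) :
    (i.val + 1 < k ∧ (finRotate k i).val = i.val + 1) ∨
      (i.val + 1 = k ∧ (finRotate k i).val = 0) := by
  cases k with
  | zero => exact i.elim0
  | succ m =>
    by_cases h : i = Fin.last m
    · subst h
      right
      simp
    · left
      have h1 : i.val ≠ m := fun h' => h (Fin.ext h')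
      exact ⟨by omega, coe_finRotate_of_ne_last h⟩

theorem leftCycle_adj (hr : 3 ≤ r) (hs : 3 ≤ s) (i : Fin r) :
    (dumbbell r s ℓ).Adj (leftCycle hs i) (leftCycle hs (finRotate r i)) := by
  have h := finRotate_val i
  simp only [dumbbell, SimpleGraph.fromRel_adj, leftCycle, ne_eq, Fin.mk.injEq]
  omega

theorem rightCycle_adj (hr : 3 ≤ r) (hs : 3 ≤ s) (i : Fin s) :
    (dumbbell r s ℓ).Adj (rightCycle hr i) (rightCycle hr (finRotate s i)) := by
  have h := finRotate_val i
  simp only [dumbbell, SimpleGraph.fromRel_adj, rightCycle, ne_eq, Fin.mk.injEq]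
  omega

/-- The gain `γ_r` of the cycle `C_r`. -/
noncomputable def gainLeft (hr : 3 ≤ r) (hs : 3 ≤ s) (Φ : UnitGain (dumbbell r s ℓ)) : Circle :=
  Φ.cycleGain (leftCycle hs) (leftCycle_adj hr hs)

/-- The gain `γ_s` of the cycle `C_s`. -/
noncomputable def gainRight (hr : 3 ≤ r) (hs : 3 ≤ s) (Φ : UnitGain (dumbbell r s ℓ)) : Circle :=
  Φ.cycleGain (rightCycle hr) (rightCycle_adj hr hs)

/-- `α = (-1)^{r/2} Re γ_r`, used for even `r`. -/
noncomputable def alpha (hr : 3 ≤ r) (hs : 3 ≤ s) (Φ : UnitGain (dumbbell r s ℓ)) : ℝ :=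
  (-1) ^ (r / 2) * (gainLeft hr hs Φ : ℂ).re

/-- `β = (-1)^{(s+1)/2} Re γ_s`, used for odd `s`. -/
noncomputable def beta (hr : 3 ≤ r) (hs : 3 ≤ s) (Φ : UnitGain (dumbbell r s ℓ)) : ℝ :=
  (-1) ^ ((s + 1) / 2) * (gainRight hr hs Φ : ℂ).re

end dumbbell

/-!
The potential `∑ λ, (x log (x² + λ²) + 2 |λ| arctan (x / |λ|))` over the eigenvalues vanishes at
`0`, has derivative `log (∏ λ, (x² + λ²)) + const`, and grows like `π` times the energy after
subtracting a term that depends only on `x` and the number of vertices. Hence a graph whose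
determinant `|det (x + i A)|² = ∏ λ, (x² + λ²)` is larger for all `x > 0` has the larger energy;
this is Coulson's integral formula without the integral.

For the dumbbell the determinant is computed by deleting edges: cutting the bridges of the
connecting path leaves a three-term recurrence and the two cycles, and opening a cycle `C_k` with
gain `γ` shows that its determinant is a Lucas polynomial in `x` minus `2 (-i)^k Re γ`. The even
cycle therefore contributes a real term `- 2 α` and the odd one an imaginary term `- 2 β i`. All
other terms are positive for `x > 0`, so the real and imaginary parts are simultaneously largest in
absolute value for `α = -1`, `β = ±1`.
-/

section CoulsonComparison

open Filter Topology

/-- The antiderivative of `x ↦ log (x ^ 2 + a ^ 2) + 2` vanishing at `0`: the potential through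
which the products `∏ i, (x ^ 2 + a i ^ 2)` control the sum `∑ i, |a i|`. For `a = 0` the second
summand is `0` by the convention `x / 0 = 0`. -/
noncomputable def logSqPrimitive (a x : ℝ) : ℝ :=
  x * Real.log (x ^ 2 + a ^ 2) + 2 * |a| * Real.arctan (x / |a|)

theorem logSqPrimitive_zero (a : ℝ) : logSqPrimitive a 0 = 0 := by
  simp [logSqPrimitive]

theorem continuous_logSqPrimitive (a : ℝ) : Continuous (logSqPrimitive a) := by
  unfold logSqPrimitive
  rcases eq_or_ne a 0 with rfl | ha
  · suffices h : Continuous fun x : ℝ => 2 * (x * Real.log x) by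
      simpa [Real.log_pow, mul_left_comm] using h
    exact continuous_const.mul Real.continuous_mul_log
  · have hne : ∀ x : ℝ, x ^ 2 + a ^ 2 ≠ 0 := fun x => by positivity
    fun_prop (disch := assumption)

theorem hasDerivAt_logSqPrimitive (a : ℝ) {x : ℝ} (hx : 0 < x) :
    HasDerivAt (logSqPrimitive a) (Real.log (x ^ 2 + a ^ 2) + 2) x := by
  have hne : x ^ 2 + a ^ 2 ≠ 0 := by positivity
  have hsq : HasDerivAt (fun x : ℝ => x ^ 2 + a ^ 2) (2 * x) x := by
    simpa using (hasDerivAt_pow 2 x).add_const (a ^ 2)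
  have hlog := (hasDerivAt_id x).mul (hsq.log hne)
  have harctan := (((hasDerivAt_id x).div_const |a|).arctan).const_mul (2 * |a|)
  refine (hlog.add harctan).congr_deriv ?_
  rcases eq_or_ne a 0 with rfl | ha
  · simp only [ne_eq, OfNat.ofNat_ne_zero, not_false_eq_true, zero_pow, add_zero, Real.log_pow,
      Nat.cast_ofNat, one_mul, id_eq, abs_zero, mul_zero, div_zero, one_ne_zero, div_self,
      add_right_inj]
    field_simp
  · have ha' : |a| ≠ 0 := abs_ne_zero.mpr ha
    rw [← sq_abs a] at hne ⊢
    simp only [id]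
    field_simp
    ring

theorem tendsto_mul_log_sq_add_sq_sub (a : ℝ) :
    Tendsto (fun x : ℝ => x * Real.log (x ^ 2 + a ^ 2) - x * Real.log (x ^ 2)) atTop (𝓝 0) := by
  have hlim : Tendsto (fun x : ℝ => a ^ 2 / x) atTop (𝓝 0) :=
    tendsto_const_nhds.div_atTop tendsto_id
  refine tendsto_of_tendsto_of_tendsto_of_le_of_le' tendsto_const_nhds hlim ?_ ?_
  · filter_upwards [eventually_gt_atTop 0] with x hx
    have hlog : Real.log (x ^ 2) ≤ Real.log (x ^ 2 + a ^ 2) :=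
      Real.log_le_log (by positivity) (le_add_of_nonneg_right (sq_nonneg a))
    exact sub_nonneg.mpr (mul_le_mul_of_nonneg_left hlog hx.le)
  · filter_upwards [eventually_gt_atTop 0] with x hx
    have hlog := Real.log_le_sub_one_of_pos (x := (x ^ 2 + a ^ 2) / x ^ 2) (by positivity)
    calc x * Real.log (x ^ 2 + a ^ 2) - x * Real.log (x ^ 2)
        = x * Real.log ((x ^ 2 + a ^ 2) / x ^ 2) := by
          rw [Real.log_div (by positivity) (by positivity), mul_sub]
      _ ≤ x * ((x ^ 2 + a ^ 2) / x ^ 2 - 1) := mul_le_mul_of_nonneg_left hlog hx.le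
      _ = a ^ 2 / x := by field_simp; ring

theorem tendsto_logSqPrimitive_sub (a : ℝ) :
    Tendsto (fun x => logSqPrimitive a x - x * Real.log (x ^ 2)) atTop (𝓝 (Real.pi * |a|)) := by
  have harctan : Tendsto (fun x : ℝ => 2 * |a| * Real.arctan (x / |a|)) atTop
      (𝓝 (Real.pi * |a|)) := by
    rcases eq_or_ne a 0 with rfl | ha
    · simp
    · convert! ((Real.tendsto_arctan_atTop.mono_right nhdsWithin_le_nhds).comp
        (tendsto_id.atTop_div_const (abs_pos.mpr ha))).const_mul (2 * |a|) using 2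
      ring
  have h := (tendsto_mul_log_sq_add_sq_sub a).add harctan
  rw [zero_add] at h
  exact h.congr fun x => by unfold logSqPrimitive; ring

variable {ι : Type*} [Fintype ι] {a b : ι → ℝ}

theorem tendsto_sum_logSqPrimitive_sub (a b : ι → ℝ) :
    Tendsto (fun x => ∑ i, (logSqPrimitive (b i) x - logSqPrimitive (a i) x)) atTop
      (𝓝 (Real.pi * (∑ i, |b i| - ∑ i, |a i|))) := by
  rw [← Finset.sum_sub_distrib, Finset.mul_sum]
  refine tendsto_finsetSum _ fun i _ => ?_
  simpa [mul_sub] using (tendsto_logSqPrimitive_sub (b i)).sub (tendsto_logSqPrimitive_sub (a i))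

theorem hasDerivAt_sum_logSqPrimitive_sub (a b : ι → ℝ) {x : ℝ} (hx : 0 < x) :
    HasDerivAt (fun x => ∑ i, (logSqPrimitive (b i) x - logSqPrimitive (a i) x))
      (Real.log (∏ i, (x ^ 2 + b i ^ 2)) - Real.log (∏ i, (x ^ 2 + a i ^ 2))) x := by
  refine (HasDerivAt.fun_sum fun i _ => (hasDerivAt_logSqPrimitive (b i) hx).sub
    (hasDerivAt_logSqPrimitive (a i) hx)).congr_deriv ?_
  rw [Real.log_prod fun i _ => by positivity, Real.log_prod fun i _ => by positivity,
    ← Finset.sum_sub_distrib]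
  simp only [add_sub_add_right_eq_sub]

theorem monotoneOn_sum_logSqPrimitive_sub
    (h : ∀ x : ℝ, 0 < x → ∏ i, (x ^ 2 + a i ^ 2) ≤ ∏ i, (x ^ 2 + b i ^ 2)) :
    MonotoneOn (fun x => ∑ i, (logSqPrimitive (b i) x - logSqPrimitive (a i) x)) (Set.Ici 0) := by
  refine monotoneOn_of_hasDerivWithinAt_nonneg (convex_Ici 0)
    (continuous_finsetSum _ fun i _ => (continuous_logSqPrimitive (b i)).sub
      (continuous_logSqPrimitive (a i))).continuousOn
    (f' := fun x => Real.log (∏ i, (x ^ 2 + b i ^ 2)) - Real.log (∏ i, (x ^ 2 + a i ^ 2))) ?_ ?_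
  all_goals
    intro x hx
    rw [interior_Ici, Set.mem_Ioi] at hx
  · exact (hasDerivAt_sum_logSqPrimitive_sub a b hx).hasDerivWithinAt
  · exact sub_nonneg.mpr (Real.log_le_log (Finset.prod_pos fun i _ => by positivity) (h x hx))

theorem sum_logSqPrimitive_sub_le
    (h : ∀ x : ℝ, 0 < x → ∏ i, (x ^ 2 + a i ^ 2) ≤ ∏ i, (x ^ 2 + b i ^ 2)) {x : ℝ} (hx : 0 ≤ x) :
    ∑ i, (logSqPrimitive (b i) x - logSqPrimitive (a i) x) ≤
      Real.pi * (∑ i, |b i| - ∑ i, |a i|) := by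
  refine ge_of_tendsto (tendsto_sum_logSqPrimitive_sub a b) ?_
  filter_upwards [eventually_ge_atTop x] with y hxy
  exact monotoneOn_sum_logSqPrimitive_sub h hx (hx.trans hxy) hxy

theorem sum_abs_le_of_prod_sq_add_sq_le
    (h : ∀ x : ℝ, 0 < x → ∏ i, (x ^ 2 + a i ^ 2) ≤ ∏ i, (x ^ 2 + b i ^ 2)) :
    ∑ i, |a i| ≤ ∑ i, |b i| := by
  have hpi := sum_logSqPrimitive_sub_le h le_rfl
  simp only [logSqPrimitive_zero, sub_zero, Finset.sum_const_zero] at hpi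
  exact sub_nonneg.mp (nonneg_of_mul_nonneg_right hpi Real.pi_pos)

theorem sum_abs_lt_of_prod_sq_add_sq_le_of_lt
    (h : ∀ x : ℝ, 0 < x → ∏ i, (x ^ 2 + a i ^ 2) ≤ ∏ i, (x ^ 2 + b i ^ 2))
    {x : ℝ} (hx : 0 < x) (hlt : ∏ i, (x ^ 2 + a i ^ 2) < ∏ i, (x ^ 2 + b i ^ 2)) :
    ∑ i, |a i| < ∑ i, |b i| := by
  refine (sum_abs_le_of_prod_sq_add_sq_le h).lt_of_ne fun heq => hlt.ne ?_
  -- With equal sums the potential increases from `0` to the limit `0`, so it is constant.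
  have hconst : (fun y => ∑ i, (logSqPrimitive (b i) y - logSqPrimitive (a i) y)) =ᶠ[𝓝 x]
      fun _ => 0 := by
    filter_upwards [lt_mem_nhds hx] with y hy
    refine le_antisymm ?_ ?_
    · simpa [heq] using sum_logSqPrimitive_sub_le h hy.le
    · simpa [logSqPrimitive_zero] using
        monotoneOn_sum_logSqPrimitive_sub h Set.self_mem_Ici hy.le hy.le
  have hderiv := (hasDerivAt_sum_logSqPrimitive_sub a b hx).unique
    ((hasDerivAt_const x 0).congr_of_eventuallyEq hconst)
  have hpos (c : ι → ℝ) : 0 < ∏ i, (x ^ 2 + c i ^ 2) := Finset.prod_pos fun i _ => by positivity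
  exact (Real.log_injOn_pos (hpos b) (hpos a) (sub_eq_zero.mp hderiv)).symm

theorem normSq_det_smul_one_add_I_smul {n : Type*} [Fintype n] [DecidableEq n]
    {A : Matrix n n ℂ} (hA : A.IsHermitian) (x : ℝ) :
    Complex.normSq ((x : ℂ) • (1 : Matrix n n ℂ) + Complex.I • A).det =
      ∏ i, (x ^ 2 + hA.eigenvalues i ^ 2) := by
  have hcharpoly := congrArg (Polynomial.eval (Complex.I * x)) hA.charpoly_eq
  rw [Matrix.eval_charpoly, Polynomial.eval_prod] at hcharpoly
  have hsmul : (x : ℂ) • (1 : Matrix n n ℂ) + Complex.I • A =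
      (-Complex.I) • (Matrix.scalar n (Complex.I * x) - A) := by
    rw [smul_sub, Matrix.scalar_apply, ← Matrix.smul_one_eq_diagonal, smul_smul, ← mul_assoc,
      neg_mul, Complex.I_mul_I, neg_neg, one_mul, neg_smul, sub_neg_eq_add]
  rw [hsmul, Matrix.det_smul, hcharpoly, map_mul, map_pow, Complex.normSq_neg, Complex.normSq_I,
    one_pow, one_mul, map_prod]
  refine Finset.prod_congr rfl fun i _ => ?_
  simp only [Complex.coe_algebraMap, Polynomial.eval_sub, Polynomial.eval_X, Polynomial.eval_C,
    Complex.normSq_apply, Complex.sub_re, Complex.mul_re, Complex.I_re, Complex.ofReal_re, zero_mul,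
    Complex.I_im, Complex.ofReal_im, mul_zero, sub_self, zero_sub, mul_neg, neg_mul, neg_neg,
    Complex.sub_im, Complex.mul_im, one_mul, zero_add, sub_zero]
  ring

end CoulsonComparison

namespace UnitGain

variable {V : Type*} {G : SimpleGraph V} [Fintype V] [DecidableEq V]

theorem energy_eq_sum (Φ : UnitGain G) :
    Φ.energy = ∑ i, |Φ.adjMatrix_isHermitian.eigenvalues i| := by
  -- `energy` chooses the `DecidableEq` instance of `eigenvalues` classically.
  unfold energy
  congr!

theorem energy_le_of_normSq_det_le {Φ Ψ : UnitGain G}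
    (h : ∀ x : ℝ, 0 < x →
      Complex.normSq ((x : ℂ) • 1 + Complex.I • Φ.adjMatrix).det ≤
        Complex.normSq ((x : ℂ) • 1 + Complex.I • Ψ.adjMatrix).det) :
    Φ.energy ≤ Ψ.energy := by
  simp only [normSq_det_smul_one_add_I_smul (adjMatrix_isHermitian _)] at h
  rw [energy_eq_sum, energy_eq_sum]
  exact sum_abs_le_of_prod_sq_add_sq_le h

theorem energy_lt_of_normSq_det_le_of_lt {Φ Ψ : UnitGain G}
    (h : ∀ x : ℝ, 0 < x →
      Complex.normSq ((x : ℂ) • 1 + Complex.I • Φ.adjMatrix).det ≤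
        Complex.normSq ((x : ℂ) • 1 + Complex.I • Ψ.adjMatrix).det)
    {x : ℝ} (hx : 0 < x)
    (hlt : Complex.normSq ((x : ℂ) • 1 + Complex.I • Φ.adjMatrix).det <
      Complex.normSq ((x : ℂ) • 1 + Complex.I • Ψ.adjMatrix).det) :
    Φ.energy < Ψ.energy := by
  simp only [normSq_det_smul_one_add_I_smul (adjMatrix_isHermitian _)] at h hlt
  rw [energy_eq_sum, energy_eq_sum]
  exact sum_abs_lt_of_prod_sq_add_sq_le_of_lt h hx hlt

end UnitGain

section Determinants

open Matrix

variable {m n R : Type*} [Fintype m] [DecidableEq m] [Fintype n] [DecidableEq n] [CommRing R]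

theorem det_add_single (A : Matrix n n R) (i j : n) (b : R) :
    (A + single i j b).det = A.det + b * A.adjugate j i := by
  have h : A + single i j b = A.updateRow i (A i + b • Pi.single j 1) := by
    ext p q
    rcases eq_or_ne p i with rfl | hp
    · simp [single_apply, Pi.single_apply, eq_comm]
    · simp [hp, hp.symm]
  rw [h, det_updateRow_add, det_updateRow_smul, updateRow_eq_self, adjugate_apply]

theorem det_updateRow_updateRow_swap (A : Matrix n n R) {i j : n} (hij : i ≠ j) (v w : n → R) :
    ((A.updateRow i v).updateRow j w).det = -((A.updateRow i w).updateRow j v).det := by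
  have h : (A.updateRow i v).updateRow j w =
      ((A.updateRow i w).updateRow j v).submatrix (Equiv.swap i j) id := by
    ext p q
    rcases eq_or_ne p j with rfl | hpj
    · simp [hij]
    · rcases eq_or_ne p i with rfl | hpi
      · simp [hij]
      · simp [hpi, hpj, Equiv.swap_apply_of_ne_of_ne]
  rw [h, det_permute, Equiv.Perm.sign_swap hij]
  simp

theorem det_add_single_add_single (A : Matrix n n R) {i j : n} (hij : i ≠ j) (b c : R) :
    (A + single i j b + single j i c).det = A.det + b * A.adjugate j i + c * A.adjugate i j -
      b * c * ((A.updateRow i (Pi.single i 1)).updateRow j (Pi.single j 1)).det := by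
  have h : (A + single i j b).updateRow j (Pi.single i 1) =
      A.updateRow j (Pi.single i 1) + single i j b := by
    ext p q
    rcases eq_or_ne p j with rfl | hp
    · simp [hij]
    · simp [hp]
  rw [det_add_single, det_add_single, adjugate_apply _ i j, h, det_add_single,
    adjugate_apply (A.updateRow j _) j i, ← adjugate_apply A i j, updateRow_comm _ hij.symm,
    det_updateRow_updateRow_swap A hij]
  ring

theorem det_fromBlocks_single_single (A : Matrix m m R) (D : Matrix n n R) (u : m) (v : n)
    (b c : R) :
    (fromBlocks A (single u v b) (single v u c) D).det =
      A.det * D.det - b * c * (A.adjugate u u * D.adjugate v v) := by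
  have hsplit : fromBlocks A (single u v b) (single v u c) D =
      fromBlocks A 0 0 D + single (Sum.inl u) (Sum.inr v) b +
        single (Sum.inr v) (Sum.inl u) c := by
    ext (p | p) (q | q) <;> simp [single_apply]
  have hupper : (fromBlocks A 0 0 D).adjugate (Sum.inr v) (Sum.inl u) = 0 := by
    have h : (fromBlocks A 0 0 D).updateRow (Sum.inl u) (Pi.single (Sum.inr v) 1) =
        fromBlocks (A.updateRow u 0) (single u v 1) 0 D := by
      ext (p | p) (q | q) <;>
        simp [updateRow_apply, single_apply, Pi.single_apply, ite_and, eq_comm]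
    rw [adjugate_apply, h, det_fromBlocks_zero₂₁, det_eq_zero_of_row_eq_zero u (by simp), zero_mul]
  have hlower : (fromBlocks A 0 0 D).adjugate (Sum.inl u) (Sum.inr v) = 0 := by
    have h : (fromBlocks A 0 0 D).updateRow (Sum.inr v) (Pi.single (Sum.inl u) 1) =
        fromBlocks A 0 (single v u 1) (D.updateRow v 0) := by
      ext (p | p) (q | q) <;>
        simp [updateRow_apply, single_apply, Pi.single_apply, ite_and, eq_comm]
    rw [adjugate_apply, h, det_fromBlocks_zero₁₂, det_eq_zero_of_row_eq_zero v (by simp), mul_zero]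
  have hdiag : ((fromBlocks A 0 0 D).updateRow (Sum.inl u) (Pi.single (Sum.inl u) 1)).updateRow
      (Sum.inr v) (Pi.single (Sum.inr v) 1) =
      fromBlocks (A.updateRow u (Pi.single u 1)) 0 0 (D.updateRow v (Pi.single v 1)) := by
    ext (p | p) (q | q) <;> simp [updateRow_apply, Pi.single_apply]
  rw [hsplit, det_add_single_add_single _ Sum.inl_ne_inr, hdiag, hupper, hlower,
    det_fromBlocks_zero₂₁, det_fromBlocks_zero₂₁, ← adjugate_apply, ← adjugate_apply]
  ring

theorem adjugate_zero_zero {n : ℕ} (A : Matrix (Fin (n + 1)) (Fin (n + 1)) R) :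
    A.adjugate 0 0 = (A.submatrix Fin.succ Fin.succ).det := by
  simp [adjugate_fin_succ_eq_det_submatrix]

theorem adjugate_last_last {n : ℕ} (A : Matrix (Fin (n + 1)) (Fin (n + 1)) R) :
    A.adjugate (Fin.last n) (Fin.last n) = (A.submatrix Fin.castSucc Fin.castSucc).det := by
  simp [adjugate_fin_succ_eq_det_submatrix, ← two_mul, Fin.succAbove_last]

theorem det_add_corners {n : ℕ} (A : Matrix (Fin (n + 2)) (Fin (n + 2)) R) (b c : R) :
    (A + single 0 (Fin.last _) b + single (Fin.last _) 0 c).det = A.det +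
      (-1) ^ (n + 1) * (b * (A.submatrix Fin.succ Fin.castSucc).det +
        c * (A.submatrix Fin.castSucc Fin.succ).det) -
      b * c * ((A.submatrix Fin.castSucc Fin.castSucc).submatrix Fin.succ Fin.succ).det := by
  have hupdate : (A.updateRow 0 (Pi.single 0 1)).submatrix Fin.castSucc Fin.castSucc =
      (A.submatrix Fin.castSucc Fin.castSucc).updateRow 0 (Pi.single 0 1) := by
    ext p q
    rcases eq_or_ne p 0 with rfl | hp
    · simp [Pi.single_apply]
    · simp [hp]
  rw [det_add_single_add_single _ Fin.last_pos.ne, ← adjugate_apply, adjugate_last_last, hupdate,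
    ← adjugate_apply, adjugate_zero_zero, adjugate_fin_succ_eq_det_submatrix,
    adjugate_fin_succ_eq_det_submatrix, Fin.succAbove_zero, Fin.succAbove_last]
  simp only [Fin.val_last, Fin.val_zero, zero_add, add_zero]
  ring

end Determinants
section IntervalBlock

open Matrix

variable {R : Type*}

/-- The principal submatrix of an infinite matrix on the `n` indices `a, a + 1, …, a + n - 1`.
Indexing by `ℕ` lets the blocks of a graph with a linear layout be cut out without casts. -/
def intervalBlock (M : Matrix ℕ ℕ R) (a n : ℕ) : Matrix (Fin n) (Fin n) R :=
  M.submatrix (fun i => a + i) (fun i => a + i)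

theorem intervalBlock_submatrix_castSucc (M : Matrix ℕ ℕ R) (a n : ℕ) :
    (intervalBlock M a (n + 1)).submatrix Fin.castSucc Fin.castSucc = intervalBlock M a n :=
  rfl

theorem intervalBlock_submatrix_succ (M : Matrix ℕ ℕ R) (a n : ℕ) :
    (intervalBlock M a (n + 1)).submatrix Fin.succ Fin.succ = intervalBlock M (a + 1) n := by
  ext i j
  simp [intervalBlock, add_assoc, add_comm 1]

variable [CommRing R]

theorem det_intervalBlock_zero (M : Matrix ℕ ℕ R) (a : ℕ) : (intervalBlock M a 0).det = 1 :=
  det_isEmpty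

theorem det_intervalBlock_one (M : Matrix ℕ ℕ R) (a : ℕ) : (intervalBlock M a 1).det = M a a := by
  simp [intervalBlock]

theorem det_intervalBlock_of_bridge {M : Matrix ℕ ℕ R} {a m n : ℕ}
    (h : ∀ i j, a ≤ i → i ≤ a + m → a + m < j → j < a + m + n + 2 →
      ¬(i = a + m ∧ j = a + m + 1) → M i j = 0 ∧ M j i = 0) :
    (intervalBlock M a (m + 1 + (n + 1))).det =
      (intervalBlock M a (m + 1)).det * (intervalBlock M (a + m + 1) (n + 1)).det -
        M (a + m) (a + m + 1) * M (a + m + 1) (a + m) *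
          ((intervalBlock M a m).det * (intervalBlock M (a + m + 2) n).det) := by
  have hblocks : (intervalBlock M a (m + 1 + (n + 1))).submatrix finSumFinEquiv finSumFinEquiv =
      fromBlocks (intervalBlock M a (m + 1))
        (single (Fin.last m) 0 (M (a + m) (a + m + 1)))
        (single 0 (Fin.last m) (M (a + m + 1) (a + m)))
        (intervalBlock M (a + m + 1) (n + 1)) := by
    have hzero (i : Fin (m + 1)) (j : Fin (n + 1)) (hij : ¬(Fin.last m = i ∧ 0 = j)) :
        M (a + i) (a + (m + 1 + j)) = 0 ∧ M (a + (m + 1 + j)) (a + i) = 0 := by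
      apply h <;> simp only [Fin.ext_iff, Fin.val_last, Fin.val_zero] at * <;> omega
    ext (i | i) (j | j)
    · simp [intervalBlock]
    · by_cases hij : Fin.last m = i ∧ 0 = j
      · simp [intervalBlock, ← hij.1, ← hij.2, add_assoc]
      · simp [intervalBlock, hij, hzero i j hij]
    · by_cases hij : Fin.last m = j ∧ 0 = i
      · simp [intervalBlock, ← hij.1, ← hij.2, add_assoc]
      · simp [intervalBlock, and_comm, hij, hzero j i hij]
    · simp [intervalBlock, add_assoc]
  rw [← det_submatrix_equiv_self finSumFinEquiv, hblocks, det_fromBlocks_single_single,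
    adjugate_last_last, adjugate_zero_zero, intervalBlock_submatrix_castSucc,
    intervalBlock_submatrix_succ]

end IntervalBlock

section FibSeq

variable {R S : Type*} [CommRing R] [CommRing S]

/-- The sequence `u, v, x v + u, …` with `f (n + 2) = x * f (n + 1) + f n`. Deleting the end vertex
of a pendant path gives this recurrence for the determinants of `x + i A` along the path. -/
def fibSeq (x u v : R) : ℕ → R
  | 0 => u
  | 1 => v
  | n + 2 => x * fibSeq x u v (n + 1) + fibSeq x u v n

/-- The Fibonacci polynomials: `det (x + i A)` for the path on `n` vertices. -/
def pathPoly (x : R) : ℕ → R :=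
  fibSeq x 1 x

/-- The Lucas polynomials: `det (x + i A)` for the cycle on `n` vertices, apart from the
contribution of the gain of the cycle. -/
def cyclePoly (x : R) : ℕ → R :=
  fibSeq x 2 x

theorem eq_fibSeq_of_recurrence {f : ℕ → R} {x : R} {N : ℕ}
    (h : ∀ n, n + 2 ≤ N → f (n + 2) = x * f (n + 1) + f n) :
    ∀ n ≤ N, f n = fibSeq x (f 0) (f 1) n
  | 0, _ => rfl
  | 1, _ => rfl
  | n + 2, hn => by
    rw [h n hn, eq_fibSeq_of_recurrence h (n + 1) (by omega),
      eq_fibSeq_of_recurrence h n (by omega), fibSeq]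

theorem map_fibSeq (φ : R →+* S) (x u v : R) :
    ∀ n, φ (fibSeq x u v n) = fibSeq (φ x) (φ u) (φ v) n
  | 0 => rfl
  | 1 => rfl
  | n + 2 => by simp only [fibSeq, map_add, map_mul, map_fibSeq]

theorem map_pathPoly (φ : R →+* S) (x : R) (n : ℕ) : φ (pathPoly x n) = pathPoly (φ x) n := by
  rw [pathPoly, map_fibSeq, map_one, pathPoly]

theorem map_cyclePoly (φ : R →+* S) (x : R) (n : ℕ) : φ (cyclePoly x n) = cyclePoly (φ x) n := by
  rw [cyclePoly, map_fibSeq, map_ofNat, cyclePoly]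

theorem pathPoly_add_two (x : R) (n : ℕ) :
    pathPoly x (n + 2) = x * pathPoly x (n + 1) + pathPoly x n :=
  rfl

theorem cyclePoly_add_two (x : R) : ∀ n, cyclePoly x (n + 2) = pathPoly x (n + 2) + pathPoly x n
  | 0 => by simp only [cyclePoly, pathPoly, fibSeq]; ring
  | 1 => by simp only [cyclePoly, pathPoly, fibSeq]; ring
  | n + 2 => by
    have hcycle : cyclePoly x (n + 2 + 2) = x * cyclePoly x (n + 1 + 2) + cyclePoly x (n + 2) := rfl
    rw [hcycle, cyclePoly_add_two x n, cyclePoly_add_two x (n + 1), pathPoly_add_two x (n + 2),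
      pathPoly_add_two x n]
    ring

end FibSeq

section PathBlock

open Matrix

variable {R : Type*} [CommRing R] {M : Matrix ℕ ℕ R} {x : R} {a n : ℕ}

/-- On the indices `a, …, a + n - 1` the matrix `M` looks like `x + i A` for a path with these
consecutive vertices and arbitrary unit gains: tridiagonal with diagonal `x`, and the two entries
of each edge multiply to `i γ * (i γ⁻¹) = -1`. -/
structure IsPathBlock (M : Matrix ℕ ℕ R) (x : R) (a n : ℕ) : Prop where
  diag : ∀ i, a ≤ i → i < a + n → M i i = x
  mul_swap : ∀ i, a ≤ i → i + 1 < a + n → M i (i + 1) * M (i + 1) i = -1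
  eq_zero : ∀ i j, a ≤ i → i + 1 < j → j < a + n → M i j = 0 ∧ M j i = 0

namespace IsPathBlock

theorem mono (h : IsPathBlock M x a n) {b m : ℕ} (hab : a ≤ b) (hbm : b + m ≤ a + n) :
    IsPathBlock M x b m where
  diag i hi hin := h.diag i (by omega) (by omega)
  mul_swap i hi hin := h.mul_swap i (by omega) (by omega)
  eq_zero i j hi hij hj := h.eq_zero i j (by omega) hij (by omega)

theorem congr (h : IsPathBlock M x a n) {T : Matrix ℕ ℕ R}
    (hT : ∀ i j, a ≤ i → i < a + n → a ≤ j → j < a + n → T i j = M i j) :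
    IsPathBlock T x a n where
  diag i hi hin := by
    rw [hT i i hi hin hi hin, h.diag i hi hin]
  mul_swap i hi hin := by
    rw [hT _ _ hi (by omega) (by omega) hin, hT _ _ (by omega) hin hi (by omega),
      h.mul_swap i hi hin]
  eq_zero i j hi hij hj := by
    rw [hT _ _ hi (by omega) (by omega) hj, hT _ _ (by omega) hj hi (by omega)]
    exact h.eq_zero i j hi hij hj

theorem glue (h : IsPathBlock M x a (n + 2)) (h' : IsPathBlock M x (a + 1) (n + 2))
    (hcorner : M a (a + (n + 2)) = 0 ∧ M (a + (n + 2)) a = 0) : IsPathBlock M x a (n + 3) where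
  diag i hi hin := by
    rcases hi.eq_or_lt with rfl | hi
    · exact h.diag _ le_rfl (by omega)
    · exact h'.diag _ hi (by omega)
  mul_swap i hi hin := by
    rcases hi.eq_or_lt with rfl | hi
    · exact h.mul_swap _ le_rfl (by omega)
    · exact h'.mul_swap _ hi (by omega)
  eq_zero i j hi hij hj := by
    rcases hi.eq_or_lt with rfl | hi
    · rcases (show j ≤ a + (n + 2) by omega).eq_or_lt with rfl | hj
      · exact hcorner
      · exact h.eq_zero _ _ le_rfl hij hj
    · exact h'.eq_zero _ _ hi hij (by omega)

theorem transpose (h : IsPathBlock M x a n) : IsPathBlock Mᵀ x a n where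
  diag := h.diag
  mul_swap i hi hin := (mul_comm _ _).trans (h.mul_swap i hi hin)
  eq_zero i j hi hij hj := (h.eq_zero i j hi hij hj).symm

theorem det_eq_pathPoly (h : IsPathBlock M x a n) : (intervalBlock M a n).det = pathPoly x n := by
  have hrec (k : ℕ) (hk : k + 2 ≤ n) : (intervalBlock M a (k + 2)).det =
      x * (intervalBlock M a (k + 1)).det + (intervalBlock M a k).det := by
    rw [det_intervalBlock_of_bridge (m := k) (n := 0) fun i j hi him hj hjn hij =>
        h.eq_zero i j hi (by omega) (by omega),
      det_intervalBlock_one, det_intervalBlock_zero, h.diag (a + k + 1) (by omega) (by omega),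
      h.mul_swap (a + k) (by omega) (by omega)]
    ring
  rcases n with - | n
  · exact det_intervalBlock_zero M a
  · rw [eq_fibSeq_of_recurrence (f := fun k => (intervalBlock M a k).det) hrec _ le_rfl,
      det_intervalBlock_zero, det_intervalBlock_one, h.diag a le_rfl (by omega), pathPoly]

theorem det_submatrix_succ_castSucc (h : IsPathBlock M x a (n + 1)) :
    ((intervalBlock M a (n + 1)).submatrix Fin.succ Fin.castSucc).det =
      ∏ i ∈ Finset.range n, M (a + i + 1) (a + i) := by
  rw [det_of_isUpperTriangular fun i j hij => ?_, ← Fin.prod_univ_eq_prod_range]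
  · simp [intervalBlock, add_assoc]
  · have hij : j.val < i.val := hij
    exact (h.eq_zero (a + j) (a + (i + 1)) (by omega) (by omega) (by omega)).2

theorem det_submatrix_castSucc_succ (h : IsPathBlock M x a (n + 1)) :
    ((intervalBlock M a (n + 1)).submatrix Fin.castSucc Fin.succ).det =
      ∏ i ∈ Finset.range n, M (a + i) (a + i + 1) := by
  rw [← det_transpose]
  exact h.transpose.det_submatrix_succ_castSucc

end IsPathBlock

theorem det_intervalBlock_of_cycle (h : IsPathBlock M x a (n + 2))
    (h' : IsPathBlock M x (a + 1) (n + 2))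
    (hcorner : M a (a + (n + 2)) * M (a + (n + 2)) a = -1) :
    (intervalBlock M a (n + 3)).det = cyclePoly x (n + 3) + (-1) ^ n *
      (M a (a + (n + 2)) * ∏ i ∈ Finset.range (n + 2), M (a + i + 1) (a + i) +
        M (a + (n + 2)) a * ∏ i ∈ Finset.range (n + 2), M (a + i) (a + i + 1)) := by
  -- Removing the corner entries opens the cycle into a path.
  obtain ⟨T, hT⟩ : ∃ T : Matrix ℕ ℕ R, T = M - single a (a + (n + 2)) (M a (a + (n + 2))) -
    single (a + (n + 2)) a (M (a + (n + 2)) a) := ⟨_, rfl⟩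
  have hTM (i j : ℕ) (hij : i + (n + 2) ≠ j) (hji : j + (n + 2) ≠ i) : T i j = M i j := by
    rw [hT, Matrix.sub_apply, Matrix.sub_apply, single_apply, single_apply, if_neg (by omega),
      if_neg (by omega), sub_zero, sub_zero]
  have hpath : IsPathBlock T x a (n + 3) :=
    (h.congr fun i j _ _ _ _ => hTM i j (by omega) (by omega)).glue
      (h'.congr fun i j _ _ _ _ => hTM i j (by omega) (by omega)) (by simp [hT])
  have hcorners : intervalBlock M a (n + 3) = intervalBlock T a (n + 3) +
      single 0 (Fin.last (n + 2)) (M a (a + (n + 2))) +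
        single (Fin.last (n + 2)) 0 (M (a + (n + 2)) a) := by
    ext i j
    simp only [hT, intervalBlock, submatrix_apply, Matrix.add_apply, Matrix.sub_apply,
      single_apply, Fin.ext_iff, Fin.val_zero, Fin.val_last, left_eq_add, add_right_inj,
      @eq_comm ℕ 0]
    ring
  have hinner : IsPathBlock T x (a + 1) (n + 1) := hpath.mono (by omega) (by omega)
  rw [hcorners, det_add_corners, intervalBlock_submatrix_castSucc, intervalBlock_submatrix_succ,
    hpath.det_eq_pathPoly, hinner.det_eq_pathPoly, hpath.det_submatrix_succ_castSucc,
    hpath.det_submatrix_castSucc_succ, hcorner, cyclePoly_add_two,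
    Finset.prod_congr rfl fun i _ => hTM (a + i + 1) (a + i) (by omega) (by omega),
    Finset.prod_congr rfl fun i _ => hTM (a + i) (a + i + 1) (by omega) (by omega)]
  ring

end PathBlock

section Monotonicity

variable {R : Type*} [CommRing R] [LinearOrder R] [IsStrictOrderedRing R] {x u v u' v' : R}

theorem fibSeq_pos (hx : 0 < x) (hu : 0 < u) (hv : 0 < v) : ∀ n, 0 < fibSeq x u v n
  | 0 => hu
  | 1 => hv
  | n + 2 => add_pos (mul_pos hx (fibSeq_pos hx hu hv (n + 1))) (fibSeq_pos hx hu hv n)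

theorem pathPoly_pos (hx : 0 < x) (n : ℕ) : 0 < pathPoly x n :=
  fibSeq_pos hx one_pos hx n

theorem cyclePoly_pos (hx : 0 < x) (n : ℕ) : 0 < cyclePoly x n :=
  fibSeq_pos hx two_pos hx n

theorem abs_fibSeq_le (hx : 0 ≤ x) (hu : |u| ≤ u') (hv : |v| ≤ v') :
    ∀ n, |fibSeq x u v n| ≤ fibSeq x u' v' n
  | 0 => hu
  | 1 => hv
  | n + 2 => by
    refine (abs_add_le _ _).trans (add_le_add ?_ (abs_fibSeq_le hx hu hv n))
    rw [abs_mul, abs_of_nonneg hx]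
    exact mul_le_mul_of_nonneg_left (abs_fibSeq_le hx hu hv (n + 1)) hx

theorem abs_fibSeq_succ_lt (hx : 0 < x) (hu : |u| ≤ u') (hv : |v| < v') :
    ∀ n, |fibSeq x u v (n + 1)| < fibSeq x u' v' (n + 1)
  | 0 => hv
  | n + 1 => by
    refine (abs_add_le _ _).trans_lt (add_lt_add_of_lt_of_le ?_ (abs_fibSeq_le hx.le hu hv.le n))
    rw [abs_mul, abs_of_pos hx]
    exact mul_lt_mul_of_pos_left (abs_fibSeq_succ_lt hx hu hv n) hx

end Monotonicity

/-- `det (x + i A)` for a cycle `C_r` with `α = (-1) ^ (r / 2) Re γ`, `r` even, and a path with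
`j - 1` further vertices attached to it; `j = 0` removes a vertex of the cycle instead. -/
def lollipopPoly {R : Type*} [CommRing R] (x : R) (r : ℕ) (α : R) : ℕ → R :=
  fibSeq x (pathPoly x (r - 1)) (cyclePoly x r - 2 * α)

theorem map_lollipopPoly {R S : Type*} [CommRing R] [CommRing S] (φ : R →+* S) (x : R) (r : ℕ)
    (α : R) (j : ℕ) : φ (lollipopPoly x r α j) = lollipopPoly (φ x) r (φ α) j := by
  rw [lollipopPoly, map_fibSeq, map_pathPoly, map_sub, map_cyclePoly, map_mul, map_ofNat,
    lollipopPoly]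

namespace dumbbell

variable {r s ℓ : ℕ}

/-- `|det (x + i A)| ^ 2` for a gain graph on the dumbbell with `r` even and `s` odd; the second
square is the contribution of the gain of the odd cycle. -/
def normSqPoly (x : ℝ) (r s ℓ : ℕ) (α β : ℝ) : ℝ :=
  (lollipopPoly x r α ℓ * cyclePoly x s + lollipopPoly x r α (ℓ - 1) * pathPoly x (s - 1)) ^ 2 +
    (2 * β * lollipopPoly x r α ℓ) ^ 2

section Maximize

variable {x α β β' : ℝ}

theorem normSqPoly_lt_of_neg_one_lt (hx : 0 < x) (hℓ : 1 ≤ ℓ) (hα : -1 < α) (hα' : α ≤ 1)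
    (hβ : β ^ 2 ≤ 1) (hβ' : β' ^ 2 = 1) :
    normSqPoly x r s ℓ α β < normSqPoly x r s ℓ (-1) β' := by
  have hC := cyclePoly_pos hx s
  have hP := pathPoly_pos hx (s - 1)
  have hu : |pathPoly x (r - 1)| ≤ pathPoly x (r - 1) := (abs_of_pos (pathPoly_pos hx _)).le
  have hv : |cyclePoly x r - 2 * α| < cyclePoly x r - 2 * -1 := by
    rw [abs_lt]
    constructor <;> linarith [cyclePoly_pos hx r]
  obtain ⟨m, rfl⟩ := Nat.exists_eq_add_of_le' hℓ
  have hlt : |lollipopPoly x r α (m + 1)| < lollipopPoly x r (-1) (m + 1) :=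
    abs_fibSeq_succ_lt hx hu hv m
  have hle : |lollipopPoly x r α m| ≤ lollipopPoly x r (-1) m := abs_fibSeq_le hx.le hu hv.le m
  rw [normSqPoly, normSqPoly, m.add_sub_cancel]
  refine add_lt_add_of_lt_of_le (sq_lt_sq.mpr ?_) ?_
  · calc |lollipopPoly x r α (m + 1) * cyclePoly x s + lollipopPoly x r α m * pathPoly x (s - 1)|
        ≤ |lollipopPoly x r α (m + 1)| * cyclePoly x s +
            |lollipopPoly x r α m| * pathPoly x (s - 1) := by
          simpa only [abs_mul, abs_of_pos hC, abs_of_pos hP] using abs_add_le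
            (lollipopPoly x r α (m + 1) * cyclePoly x s) (lollipopPoly x r α m * pathPoly x (s - 1))
      _ < lollipopPoly x r (-1) (m + 1) * cyclePoly x s +
            lollipopPoly x r (-1) m * pathPoly x (s - 1) :=
          add_lt_add_of_lt_of_le (mul_lt_mul_of_pos_right hlt hC)
            (mul_le_mul_of_nonneg_right hle hP.le)
      _ ≤ _ := le_abs_self _
  · have hsq : lollipopPoly x r α (m + 1) ^ 2 ≤ lollipopPoly x r (-1) (m + 1) ^ 2 :=
      sq_le_sq.mpr (hlt.le.trans (le_abs_self _))
    rw [mul_pow, mul_pow, mul_pow, mul_pow, hβ']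
    gcongr

theorem normSqPoly_neg_one_lt (hx : 0 < x) (hβ : β ^ 2 < 1) (hβ' : β' ^ 2 = 1) :
    normSqPoly x r s ℓ (-1) β < normSqPoly x r s ℓ (-1) β' := by
  have hpos : 0 < lollipopPoly x r (-1) ℓ :=
    fibSeq_pos hx (pathPoly_pos hx _) (by linarith [cyclePoly_pos hx r]) ℓ
  simp only [normSqPoly, mul_pow, hβ']
  gcongr

theorem normSqPoly_lt (hx : 0 < x) (hℓ : 1 ≤ ℓ) (hα : |α| ≤ 1) (hβ : |β| ≤ 1) (hβ' : β' ^ 2 = 1)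
    (h : ¬(α = -1 ∧ β ^ 2 = 1)) : normSqPoly x r s ℓ α β < normSqPoly x r s ℓ (-1) β' := by
  have hβ_sq := (sq_le_one_iff_abs_le_one β).mpr hβ
  rcases (abs_le.mp hα).1.eq_or_lt with rfl | hlt
  · exact normSqPoly_neg_one_lt hx (hβ_sq.lt_of_ne fun h1 => h ⟨rfl, h1⟩) hβ'
  · exact normSqPoly_lt_of_neg_one_lt hx hℓ hlt (abs_le.mp hα).2 hβ_sq hβ'

theorem normSqPoly_le (hx : 0 < x) (hℓ : 1 ≤ ℓ) (hα : |α| ≤ 1) (hβ : |β| ≤ 1) (hβ' : β' ^ 2 = 1) :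
    normSqPoly x r s ℓ α β ≤ normSqPoly x r s ℓ (-1) β' := by
  by_cases h : α = -1 ∧ β ^ 2 = 1
  · simp only [normSqPoly, mul_pow, h.1, h.2, hβ', le_refl]
  · exact (normSqPoly_lt hx hℓ hα hβ hβ' h).le

end Maximize

end dumbbell

namespace UnitGain

variable {n : ℕ} {G : SimpleGraph (Fin n)} (Φ : UnitGain G)

/-- The Hermitian adjacency matrix of a gain graph on the vertices `0, …, n - 1`, extended by
zero to an infinite matrix. -/
noncomputable def natAdjMatrix : Matrix ℕ ℕ ℂ :=
  Matrix.of fun i j => if h : i < n ∧ j < n then Φ.adjMatrix ⟨i, h.1⟩ ⟨j, h.2⟩ else 0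

/-- The matrix `x + i A` whose determinant enters Coulson's energy formula. -/
noncomputable def coulsonMatrix (x : ℝ) : Matrix ℕ ℕ ℂ :=
  (x : ℂ) • 1 + Complex.I • Φ.natAdjMatrix

variable {i j : ℕ} {x : ℝ}

theorem natAdjMatrix_of_adj (hi : i < n) (hj : j < n) (h : G.Adj ⟨i, hi⟩ ⟨j, hj⟩) :
    Φ.natAdjMatrix i j = Φ.gain ⟨(⟨i, hi⟩, ⟨j, hj⟩), h⟩ := by
  simp [natAdjMatrix, adjMatrix, hi, hj, h]

theorem natAdjMatrix_eq_zero (h : ∀ hi hj, ¬G.Adj ⟨i, hi⟩ ⟨j, hj⟩) : Φ.natAdjMatrix i j = 0 := by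
  simp [natAdjMatrix, adjMatrix, h]

theorem natAdjMatrix_isHermitian : Φ.natAdjMatrix.IsHermitian := by
  ext i j
  by_cases h : i < n ∧ j < n
  · simpa [natAdjMatrix, h.1, h.2] using Φ.adjMatrix_isHermitian.apply ⟨i, h.1⟩ ⟨j, h.2⟩
  · simp [natAdjMatrix, h, and_comm (a := j < n)]

theorem coulsonMatrix_self : Φ.coulsonMatrix x i i = x := by
  simp [coulsonMatrix, natAdjMatrix_eq_zero]

theorem coulsonMatrix_of_ne (hij : i ≠ j) :
    Φ.coulsonMatrix x i j = Complex.I * Φ.natAdjMatrix i j := by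
  simp [coulsonMatrix, hij]

theorem coulsonMatrix_mul_swap (hi : i < n) (hj : j < n) (h : G.Adj ⟨i, hi⟩ ⟨j, hj⟩) :
    Φ.coulsonMatrix x i j * Φ.coulsonMatrix x j i = -1 := by
  have hij : i ≠ j := fun hij => h.ne (Fin.ext hij)
  rw [coulsonMatrix_of_ne Φ hij, coulsonMatrix_of_ne Φ hij.symm, mul_mul_mul_comm, Complex.I_mul_I,
    ← Φ.natAdjMatrix_isHermitian.apply j i, natAdjMatrix_of_adj Φ hi hj h, Complex.star_def,
    Complex.mul_conj, Circle.normSq_coe, Complex.ofReal_one, mul_one]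

theorem coulsonMatrix_eq_zero (hij : i ≠ j) (h : ∀ hi hj, ¬G.Adj ⟨i, hi⟩ ⟨j, hj⟩) :
    Φ.coulsonMatrix x i j = 0 := by
  rw [coulsonMatrix_of_ne Φ hij, natAdjMatrix_eq_zero Φ h, mul_zero]

theorem intervalBlock_coulsonMatrix (x : ℝ) :
    intervalBlock (Φ.coulsonMatrix x) 0 n = (x : ℂ) • 1 + Complex.I • Φ.adjMatrix := by
  ext i j
  simp [intervalBlock, coulsonMatrix, natAdjMatrix, Matrix.one_apply, Fin.ext_iff]

theorem cycleGain_eq_prod_natAdjMatrix {k a : ℕ} (c : Fin (k + 1) → Fin n)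
    (hc : ∀ i, G.Adj (c i) (c (finRotate (k + 1) i))) (ha : ∀ i, (c i).val = a + i.val) :
    (Φ.cycleGain c hc : ℂ) =
      (∏ i ∈ Finset.range k, Φ.natAdjMatrix (a + i) (a + i + 1)) * Φ.natAdjMatrix (a + k) a := by
  have hgain (i : Fin (k + 1)) : (Φ.gain ⟨(c i, c (finRotate (k + 1) i)), hc i⟩ : ℂ) =
      Φ.natAdjMatrix (a + i.val) (a + (finRotate (k + 1) i).val) := by
    simp only [← ha]
    exact (Φ.natAdjMatrix_of_adj (c i).2 (c _).2 (hc i)).symm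
  have hprod : (Φ.cycleGain c hc : ℂ) =
      ∏ i, (Φ.gain ⟨(c i, c (finRotate (k + 1) i)), hc i⟩ : ℂ) := map_prod Circle.coeHom _ _
  rw [hprod, Finset.prod_congr rfl fun i _ => hgain i, Fin.prod_univ_castSucc, Finset.prod_range]
  simp [add_assoc]

theorem det_coulsonMatrix_of_cycle {k a : ℕ} (c : Fin (k + 3) → Fin n)
    (hc : ∀ i, G.Adj (c i) (c (finRotate (k + 3) i))) (ha : ∀ i, (c i).val = a + i.val)
    (h : IsPathBlock (Φ.coulsonMatrix x) (x : ℂ) a (k + 2))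
    (h' : IsPathBlock (Φ.coulsonMatrix x) (x : ℂ) (a + 1) (k + 2)) :
    (intervalBlock (Φ.coulsonMatrix x) a (k + 3)).det =
      cyclePoly (x : ℂ) (k + 3) - 2 * (-Complex.I) ^ (k + 3) * (Φ.cycleGain c hc : ℂ).re := by
  have hcorner : Φ.coulsonMatrix x a (a + (k + 2)) * Φ.coulsonMatrix x (a + (k + 2)) a = -1 := by
    have hadj := hc (Fin.last (k + 2))
    rw [finRotate_last] at hadj
    simpa only [ha, Fin.val_zero, Fin.val_last, add_zero] using
      Φ.coulsonMatrix_mul_swap (x := x) (c 0).2 (c (Fin.last (k + 2))).2 hadj.symm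
  have hgain : Φ.coulsonMatrix x (a + (k + 2)) a *
      ∏ i ∈ Finset.range (k + 2), Φ.coulsonMatrix x (a + i) (a + i + 1) =
        Complex.I ^ (k + 3) * Φ.cycleGain c hc := by
    rw [Φ.cycleGain_eq_prod_natAdjMatrix c hc ha, coulsonMatrix_of_ne Φ (by omega),
      Finset.prod_congr rfl fun i _ => coulsonMatrix_of_ne Φ (show a + i ≠ a + i + 1 by omega),
      Finset.prod_mul_distrib, Finset.prod_const, Finset.card_range]
    ring
  have hgain' : Φ.coulsonMatrix x a (a + (k + 2)) *
      ∏ i ∈ Finset.range (k + 2), Φ.coulsonMatrix x (a + i + 1) (a + i) =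
        Complex.I ^ (k + 3) * star (Φ.cycleGain c hc : ℂ) := by
    rw [Φ.cycleGain_eq_prod_natAdjMatrix c hc ha, coulsonMatrix_of_ne Φ (by omega),
      Finset.prod_congr rfl fun i _ => coulsonMatrix_of_ne Φ (show a + i + 1 ≠ a + i by omega),
      Finset.prod_mul_distrib, Finset.prod_const, Finset.card_range, star_mul', star_prod]
    simp only [Φ.natAdjMatrix_isHermitian.apply]
    ring
  rw [det_intervalBlock_of_cycle h h' hcorner, hgain, hgain', ← mul_add, add_comm (star _),
    Complex.star_def, Complex.add_conj, neg_pow Complex.I]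
  push_cast
  ring

end UnitGain

namespace dumbbell

variable {r s ℓ : ℕ}

theorem adj_iff {i j : Fin (r + s + ℓ - 1)} :
    (dumbbell r s ℓ).Adj i j ↔ i.val ≠ j.val ∧
      ((i.val + 1 = j.val ∨ (i.val = 0 ∧ j.val + 1 = r) ∨
          (i.val + 1 = r + ℓ ∧ j.val + 2 = r + s + ℓ)) ∨
        (j.val + 1 = i.val ∨ (j.val = 0 ∧ i.val + 1 = r) ∨
          (j.val + 1 = r + ℓ ∧ i.val + 2 = r + s + ℓ))) := by
  simp [dumbbell, SimpleGraph.fromRel_adj, Fin.ext_iff]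

section Determinant

variable (Φ : UnitGain (dumbbell r s ℓ)) (x : ℝ)

theorem isPathBlock_coulsonMatrix {a n : ℕ} (hn : a + n ≤ r + s + ℓ - 1) (hleft : a = 0 → n < r)
    (hright : a < r + ℓ → a + n < r + s + ℓ - 1) :
    IsPathBlock (Φ.coulsonMatrix x) (x : ℂ) a n where
  diag i _ _ := Φ.coulsonMatrix_self
  mul_swap i _ hin :=
    Φ.coulsonMatrix_mul_swap (by omega) (by omega) (adj_iff.mpr (by dsimp only; omega))
  eq_zero i j hi hij hj := by
    constructor <;>
      exact Φ.coulsonMatrix_eq_zero (by omega) fun _ _ h => by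
        rw [adj_iff] at h
        dsimp only at h
        omega

theorem det_coulsonMatrix_of_bridge {m n : ℕ} (hm : r ≤ m + 1) (hm' : m + 1 < r + ℓ)
    (hn : m + n + 2 ≤ r + s + ℓ - 1) :
    (intervalBlock (Φ.coulsonMatrix x) 0 (m + 1 + (n + 1))).det =
      (intervalBlock (Φ.coulsonMatrix x) 0 (m + 1)).det *
          (intervalBlock (Φ.coulsonMatrix x) (m + 1) (n + 1)).det +
        (intervalBlock (Φ.coulsonMatrix x) 0 m).det *
          (intervalBlock (Φ.coulsonMatrix x) (m + 2) n).det := by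
  have hzero (i j : ℕ) (him : i ≤ m) (hmj : m < j) (hij : ¬(i = m ∧ j = m + 1)) :
      Φ.coulsonMatrix x i j = 0 ∧ Φ.coulsonMatrix x j i = 0 := by
    constructor <;>
      exact Φ.coulsonMatrix_eq_zero (by omega) fun _ _ h => by
        rw [adj_iff] at h
        dsimp only at h
        omega
  have hedge : Φ.coulsonMatrix x m (m + 1) * Φ.coulsonMatrix x (m + 1) m = -1 :=
    Φ.coulsonMatrix_mul_swap (by omega) (by omega) (adj_iff.mpr (by dsimp only; omega))
  rw [det_intervalBlock_of_bridge fun i j _ him hmj _ hij => hzero i j (by omega) (by omega)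
    (by omega)]
  simp only [zero_add, hedge]
  ring

theorem det_coulsonMatrix_leftCycle (hr : 3 ≤ r) (hs : 3 ≤ s) (hr_even : Even r) :
    (intervalBlock (Φ.coulsonMatrix x) 0 r).det =
      cyclePoly (x : ℂ) r - 2 * (alpha hr hs Φ : ℂ) := by
  have hpow : (-Complex.I) ^ r = (-1) ^ (r / 2) := by
    conv_lhs => rw [← Nat.two_mul_div_two_of_even hr_even, pow_mul, neg_sq, Complex.I_sq]
  obtain ⟨k, rfl⟩ := Nat.exists_eq_add_of_le' hr
  rw [Φ.det_coulsonMatrix_of_cycle (leftCycle hs) (leftCycle_adj hr hs) (by simp [leftCycle])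
    (isPathBlock_coulsonMatrix Φ x (by omega) (by omega) (by omega))
    (isPathBlock_coulsonMatrix Φ x (by omega) (by omega) (by omega)), hpow, alpha, gainLeft]
  push_cast
  ring

theorem det_coulsonMatrix_rightCycle (hr : 3 ≤ r) (hs : 3 ≤ s) (hs_odd : Odd s) :
    (intervalBlock (Φ.coulsonMatrix x) (r + ℓ - 1) s).det =
      cyclePoly (x : ℂ) s - 2 * (beta hr hs Φ : ℂ) * Complex.I := by
  have hpow : (-Complex.I) ^ s = (-1) ^ ((s + 1) / 2) * Complex.I := by
    obtain ⟨m, rfl⟩ := hs_odd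
    rw [show (2 * m + 1 + 1) / 2 = m + 1 by omega, pow_succ, pow_mul, neg_sq, Complex.I_sq]
    ring
  obtain ⟨k, rfl⟩ := Nat.exists_eq_add_of_le' hs
  rw [Φ.det_coulsonMatrix_of_cycle (rightCycle hr) (rightCycle_adj hr hs) (by simp [rightCycle])
    (isPathBlock_coulsonMatrix Φ x (by omega) (by omega) (by omega))
    (isPathBlock_coulsonMatrix Φ x (by omega) (by omega) (by omega)), hpow, beta, gainRight]
  push_cast
  ring

theorem det_coulsonMatrix_lollipop (hr : 3 ≤ r) (hs : 3 ≤ s) (hr_even : Even r) {j : ℕ}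
    (hj : j ≤ ℓ) :
    (intervalBlock (Φ.coulsonMatrix x) 0 (r - 1 + j)).det =
      lollipopPoly (x : ℂ) r (alpha hr hs Φ) j := by
  have hrec (j : ℕ) (hj : j + 2 ≤ ℓ) :
      (intervalBlock (Φ.coulsonMatrix x) 0 (r - 1 + (j + 2))).det =
      x * (intervalBlock (Φ.coulsonMatrix x) 0 (r - 1 + (j + 1))).det +
        (intervalBlock (Φ.coulsonMatrix x) 0 (r - 1 + j)).det := by
    have h := det_coulsonMatrix_of_bridge Φ x (m := r - 1 + j) (n := 0) (by omega) (by omega)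
      (by omega)
    rw [det_intervalBlock_one, det_intervalBlock_zero, Φ.coulsonMatrix_self] at h
    exact h.trans (by rw [mul_one, mul_comm]; rfl)
  rw [eq_fibSeq_of_recurrence (f := fun j =>
      (intervalBlock (Φ.coulsonMatrix x) 0 (r - 1 + j)).det) hrec j hj, lollipopPoly, add_zero,
    (isPathBlock_coulsonMatrix Φ x (by omega) (by omega) (by omega)).det_eq_pathPoly,
    Nat.sub_add_cancel (by omega), det_coulsonMatrix_leftCycle Φ x hr hs hr_even]

theorem det_coulsonMatrix (hr : 3 ≤ r) (hs : 3 ≤ s) (hℓ : 1 ≤ ℓ) (hr_even : Even r)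
    (hs_odd : Odd s) :
    (intervalBlock (Φ.coulsonMatrix x) 0 (r + s + ℓ - 1)).det =
      lollipopPoly (x : ℂ) r (alpha hr hs Φ) ℓ *
          (cyclePoly (x : ℂ) s - 2 * (beta hr hs Φ : ℂ) * Complex.I) +
        lollipopPoly (x : ℂ) r (alpha hr hs Φ) (ℓ - 1) * pathPoly (x : ℂ) (s - 1) := by
  have hpath : IsPathBlock (Φ.coulsonMatrix x) (x : ℂ) (r + ℓ) (s - 1) :=
    isPathBlock_coulsonMatrix Φ x (by omega) (by omega) (by omega)
  have h := det_coulsonMatrix_of_bridge Φ x (m := r - 1 + (ℓ - 1)) (n := s - 1) (by omega)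
    (by omega) (by omega)
  rw [show r - 1 + (ℓ - 1) + 1 + (s - 1 + 1) = r + s + ℓ - 1 by omega,
    show r - 1 + (ℓ - 1) + 1 = r - 1 + ℓ by omega, show r - 1 + (ℓ - 1) + 2 = r + ℓ by omega,
    show s - 1 + 1 = s by omega] at h
  rw [h, det_coulsonMatrix_lollipop Φ x hr hs hr_even le_rfl,
    det_coulsonMatrix_lollipop Φ x hr hs hr_even (Nat.sub_le ℓ 1),
    show r - 1 + ℓ = r + ℓ - 1 by omega, det_coulsonMatrix_rightCycle Φ x hr hs hs_odd,
    hpath.det_eq_pathPoly]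

theorem normSq_det_eq_normSqPoly (hr : 3 ≤ r) (hs : 3 ≤ s) (hℓ : 1 ≤ ℓ) (hr_even : Even r)
    (hs_odd : Odd s) :
    Complex.normSq ((x : ℂ) • 1 + Complex.I • Φ.adjMatrix).det =
      normSqPoly x r s ℓ (alpha hr hs Φ) (beta hr hs Φ) := by
  set L := lollipopPoly x r (alpha hr hs Φ)
  have hL (j : ℕ) : lollipopPoly (x : ℂ) r (alpha hr hs Φ) j = (L j : ℂ) :=
    (map_lollipopPoly Complex.ofRealHom x r _ j).symm
  have hcycle : cyclePoly (x : ℂ) s = ((cyclePoly x s : ℝ) : ℂ) :=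
    (map_cyclePoly Complex.ofRealHom x s).symm
  have hpath : pathPoly (x : ℂ) (s - 1) = ((pathPoly x (s - 1) : ℝ) : ℂ) :=
    (map_pathPoly Complex.ofRealHom x (s - 1)).symm
  have hdet : ((x : ℂ) • 1 + Complex.I • Φ.adjMatrix).det =
      ((L ℓ * cyclePoly x s + L (ℓ - 1) * pathPoly x (s - 1) : ℝ) : ℂ) +
        ((-(2 * beta hr hs Φ * L ℓ) : ℝ) : ℂ) * Complex.I := by
    rw [← Φ.intervalBlock_coulsonMatrix, det_coulsonMatrix Φ x hr hs hℓ hr_even hs_odd, hL, hL,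
      hcycle, hpath]
    push_cast
    ring
  rw [hdet, Complex.normSq_add_mul_I, neg_sq, normSqPoly]

end Determinant

theorem abs_alpha_le (hr : 3 ≤ r) (hs : 3 ≤ s) (Φ : UnitGain (dumbbell r s ℓ)) :
    |alpha hr hs Φ| ≤ 1 := by
  rw [alpha, abs_mul, abs_pow, abs_neg, abs_one, one_pow, one_mul]
  exact (Complex.abs_re_le_norm _).trans (Circle.norm_coe _).le

theorem abs_beta_le (hr : 3 ≤ r) (hs : 3 ≤ s) (Φ : UnitGain (dumbbell r s ℓ)) :
    |beta hr hs Φ| ≤ 1 := by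
  rw [beta, abs_mul, abs_pow, abs_neg, abs_one, one_pow, one_mul]
  exact (Complex.abs_re_le_norm _).trans (Circle.norm_coe _).le

section Energy

variable {Φ Ψ : UnitGain (dumbbell r s ℓ)}

theorem energy_le (hr : 3 ≤ r) (hs : 3 ≤ s) (hℓ : 1 ≤ ℓ) (hr_even : Even r) (hs_odd : Odd s)
    (hα : alpha hr hs Φ = -1) (hβ : beta hr hs Φ ^ 2 = 1) : Ψ.energy ≤ Φ.energy := by
  refine UnitGain.energy_le_of_normSq_det_le fun x hx => ?_
  rw [normSq_det_eq_normSqPoly _ _ hr hs hℓ hr_even hs_odd,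
    normSq_det_eq_normSqPoly _ _ hr hs hℓ hr_even hs_odd, hα]
  exact normSqPoly_le hx hℓ (abs_alpha_le hr hs Ψ) (abs_beta_le hr hs Ψ) hβ

theorem energy_lt (hr : 3 ≤ r) (hs : 3 ≤ s) (hℓ : 1 ≤ ℓ) (hr_even : Even r) (hs_odd : Odd s)
    (hα : alpha hr hs Φ = -1) (hβ : beta hr hs Φ ^ 2 = 1)
    (hΨ : ¬(alpha hr hs Ψ = -1 ∧ beta hr hs Ψ ^ 2 = 1)) : Ψ.energy < Φ.energy := by
  have hlt (x : ℝ) (hx : 0 < x) :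
      Complex.normSq ((x : ℂ) • 1 + Complex.I • Ψ.adjMatrix).det <
        Complex.normSq ((x : ℂ) • 1 + Complex.I • Φ.adjMatrix).det := by
    rw [normSq_det_eq_normSqPoly _ _ hr hs hℓ hr_even hs_odd,
      normSq_det_eq_normSqPoly _ _ hr hs hℓ hr_even hs_odd, hα]
    exact normSqPoly_lt hx hℓ (abs_alpha_le hr hs Ψ) (abs_beta_le hr hs Ψ) hβ hΨ
  exact UnitGain.energy_lt_of_normSq_det_le_of_lt (fun x hx => (hlt x hx).le) one_pos
    (hlt 1 one_pos)

end Energy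

end dumbbell

theorem exists_circle_re_eq {δ : ℝ} (hδ : |δ| ≤ 1) : ∃ z : Circle, (z : ℂ).re = δ :=
  ⟨Circle.exp (Real.arccos δ), by
    rw [Circle.coe_exp, Complex.exp_ofReal_mul_I_re, Real.cos_arccos (abs_le.mp hδ).1
      (abs_le.mp hδ).2]⟩

theorem exists_circle_neg_one_pow_mul_re_eq (m : ℕ) {δ : ℝ} (hδ : |δ| ≤ 1) :
    ∃ z : Circle, (-1) ^ m * (z : ℂ).re = δ := by
  obtain ⟨z, hz⟩ := exists_circle_re_eq (δ := (-1) ^ m * δ) (by simpa [abs_mul] using hδ)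
  exact ⟨z, by rw [hz, ← mul_assoc, ← mul_pow, neg_one_mul, neg_neg, one_pow, one_mul]⟩

namespace UnitGain

/-- The gain graph in which the edges `u v` with `u < v`, directed upwards, have the prescribed
gains `g u v`. -/
noncomputable def ofLT {V : Type*} [LinearOrder V] (G : SimpleGraph V) (g : V → V → Circle) :
    UnitGain G where
  gain d := if d.fst < d.snd then g d.fst d.snd else (g d.snd d.fst)⁻¹
  gain_symm d := by
    rcases d.adj.ne.lt_or_gt with h | h <;> simp [h, h.not_gt]

theorem cycleGain_ofLT {V : Type*} [LinearOrder V] {G : SimpleGraph V} (g : V → V → Circle)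
    {k : ℕ} {c : Fin (k + 1) → V} (hmono : StrictMono c)
    (hc : ∀ i, G.Adj (c i) (c (finRotate (k + 1) i))) :
    (ofLT G g).cycleGain c hc =
      (∏ i : Fin k, g (c i.castSucc) (c i.succ)) * (g (c 0) (c (Fin.last k)))⁻¹ := by
  simp [cycleGain, ofLT, Fin.prod_univ_castSucc, hmono.lt_iff_lt]

end UnitGain

namespace dumbbell

variable {r s ℓ : ℕ}

theorem exists_alpha_eq_beta_eq (hr : 3 ≤ r) (hs : 3 ≤ s) {α β : ℝ} (hα : |α| ≤ 1)
    (hβ : |β| ≤ 1) :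
    ∃ Φ : UnitGain (dumbbell r s ℓ), alpha hr hs Φ = α ∧ beta hr hs Φ = β := by
  obtain ⟨a, ha⟩ := exists_circle_neg_one_pow_mul_re_eq (r / 2) hα
  obtain ⟨b, hb⟩ := exists_circle_neg_one_pow_mul_re_eq ((s + 1) / 2) hβ
  obtain ⟨k, rfl⟩ := Nat.exists_eq_add_of_le' hr
  obtain ⟨m, rfl⟩ := Nat.exists_eq_add_of_le' hs
  -- All gains are trivial except those of the closing edges of the two cycles.
  let g (i j : Fin (k + 3 + (m + 3) + ℓ - 1)) : Circle :=
    if i.val + 1 = j.val then 1 else if i.val = 0 then a⁻¹ else b⁻¹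
  have hleft : gainLeft hr hs (.ofLT (dumbbell (k + 3) (m + 3) ℓ) g) = a := by
    rw [gainLeft, UnitGain.cycleGain_ofLT g fun i j hij => by simpa [leftCycle] using hij]
    simp [g, leftCycle]
  have hright : gainRight hr hs (.ofLT (dumbbell (k + 3) (m + 3) ℓ) g) = b := by
    rw [gainRight, UnitGain.cycleGain_ofLT g fun i j hij => by simpa [rightCycle] using hij]
    simp [g, rightCycle, add_assoc (k + 2 + ℓ)]
  exact ⟨.ofLT _ g, by rw [alpha, hleft, ha], by rw [beta, hright, hb]⟩

end dumbbell

theorem mainTheorem7 (r s ℓ : ℕ) (hr : 3 ≤ r) (hs : 3 ≤ s) (hℓ : 1 ≤ ℓ)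
    (hr_even : Even r) (hs_odd : Odd s) :
    (∀ Φ : UnitGain (dumbbell r s ℓ),
      (∀ Ψ : UnitGain (dumbbell r s ℓ), Ψ.energy ≤ Φ.energy) ↔
        dumbbell.alpha hr hs Φ = -1 ∧
          (dumbbell.beta hr hs Φ = 1 ∨ dumbbell.beta hr hs Φ = -1)) ∧
    (∃ Φ : UnitGain (dumbbell r s ℓ),
      dumbbell.alpha hr hs Φ = -1 ∧ dumbbell.beta hr hs Φ = 1) ∧
    (∃ Φ : UnitGain (dumbbell r s ℓ),
      dumbbell.alpha hr hs Φ = -1 ∧ dumbbell.beta hr hs Φ = -1) := by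
  have hexists {β : ℝ} (hβ : |β| ≤ 1) :=
    dumbbell.exists_alpha_eq_beta_eq (ℓ := ℓ) hr hs (α := -1) (by simp) hβ
  refine ⟨fun Φ => ?_, hexists (by simp), hexists (by simp)⟩
  rw [← sq_eq_one_iff]
  constructor
  · intro hmax
    by_contra hne
    obtain ⟨Φ₀, hα, hβ⟩ := hexists (β := 1) (by simp)
    exact (hmax Φ₀).not_gt
      (dumbbell.energy_lt hr hs hℓ hr_even hs_odd hα (by rw [hβ, one_pow]) hne)
  · rintro ⟨hα, hβ⟩ Ψ
    exact dumbbell.energy_le hr hs hℓ hr_even hs_odd hα hβ
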